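/- Let $\mathcal M$ be a smooth (finite-dimensional, Hausdorff, paracompact) manifold, $\mathcal R=C^\infty(\mathcal M)$, and let $\mathcal V=\mathrm{Der}_{\mathbb R}(\mathcal R)$ be the $\mathcal R$-module of smooth vector fields, with Jacobi bracket written $[\![\![a,b]\!]\!]$. Let $\nabla$ be an arbitrary affine connection on $\mathcal V$, and write $X\rhd Y=\nabla_XY$ for $X,Y\in\mathcal V$ and $X\rhd f=X.f$ for $f\in\mathcal R$. Extend $X\rhd-$ to the tensor algebra $\mathcal A=T_{\mathcal R}(\mathcal V)$ as a derivation, and extend $\rhd$ to maps $\mathcal A\times\mathcal A\to\mathcal A$ and $\mathcal A\times\mathcal R\to\mathcal R$, $\mathcal R$-linear in the first argument, by $1\rhd w=w$ and $(X\cdot U)\rhd w=X\rhd(U\rhd w)-(X\rhd U)\rhd w$ for $X\in\mathcal V$, $U\in\mathcal A$. Let $\mathfrak g=\mathrm{Lie}_{\mathcal R}(\mathcal V)\subset\mathcal A$ be the free $\mathcal R$-Lie algebra on the module $\mathcal V$, with free Lie bracket $[\cdot,\cdot]$; it is stable under $\rhd$. Equip $\mathfrak g$ with the Grossman--Larson bracket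 $$[\![u,v]\!]=u\rhd v-v\rhd u+[u,v],$$ which makes it a real Lie algebra, and let the anchor $\rho:\mathfrak g\to\mathcal V$ be the $\mathcal R$-linear map defined by $\rho(u)(f)=u\rhd f$. For $a,b\in\mathcal V$ let $$s(a.b)=[\![a,b]\!]-[\![\![a,b]\!]\!]\in\mathfrak g$$ be the curvature element. Let $\mathcal J=\ker\rho$, and let $\tilde{\mathcal J}$ be the ideal of the real Lie algebra $(\mathfrak g,[\![\cdot,\cdot]\!])$ generated by all $s(a.b)$, $a,b\in\mathcal V$. Then $$\tilde{\mathcal J}=\mathcal J,\qquad\text{and}\qquad \mathfrak g=\mathcal V\oplus\mathcal J$$ as $\mathcal R$-modules. -/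

import Mathlib

open scoped TensorProduct Manifold ContDiff

/-- For `R = C^∞(M)`, the `R`-module `V = Der(R)` of smooth vector fields, with the commutator of
derivations (the Jacobi bracket) as its bracket. -/
abbrev VecField (R : Type*) [CommRing R] [Algebra ℝ R] := Derivation ℝ R R

/-- The tensor algebra `A = T_R(V)` over `R` of the module of vector fields. -/
abbrev TensorAlg (R : Type*) [CommRing R] [Algebra ℝ R] := TensorAlgebra R (VecField R)

/-- The commutator bracket of the tensor algebra. -/
noncomputable instance TensorAlg.instLieRing (R : Type*) [CommRing R] [Algebra ℝ R] :
    LieRing (TensorAlg R) :=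
  LieRing.ofAssociativeRing

/-- A connection on an `R`-module `W` (for `R = C^∞(M)` and `W` the smooth sections of a vector
bundle this is an affine connection on the bundle): `nabla X w` is `∇_X w`; it is `R`-linear in `X`,
`ℝ`-linear in `w`, and `∇_X (f w) = (X f) w + f ∇_X w`. -/
structure ModuleConnection (R : Type*) [CommRing R] [Algebra ℝ R] (W : Type*) [AddCommGroup W]
    [Module ℝ W] [Module R W] [IsScalarTower ℝ R W] where
  nabla : VecField R →ₗ[R] Module.End ℝ W
  leibniz : ∀ (X : VecField R) (f : R) (w : W), nabla X (f • w) = X f • w + f • nabla X w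

/-- A connection on vector fields, `X ▷ Y = ∇_X Y`. -/
abbrev AffineConnection (R : Type*) [CommRing R] [Algebra ℝ R] := ModuleConnection R (VecField R)

namespace ModuleConnection

variable {R : Type*} [CommRing R] [Algebra ℝ R]

/-- The connection `X ▷ f = X f` on functions. -/
def trivial (R : Type*) [CommRing R] [Algebra ℝ R] : ModuleConnection R R where
  nabla :=
    { toFun := fun X => X.toLinearMap
      map_add' := fun _ _ => rfl
      map_smul' := fun _ _ => rfl }
  leibniz := fun X f w => by
    change X (f * w) = X f * w + f * X w
    rw [X.leibniz]; simp [mul_comm, add_comm]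

/-- For a vector field `X`, the dual numbers `A[ε]` over the tensor algebra, regarded as an
`R`-algebra through `f ↦ f + ε X f`. It serves to extend `∇_X` to a derivation of `A`. -/
def Twist (_ : VecField R) : Type _ := TrivSqZeroExt (TensorAlg R) (TensorAlg R)

noncomputable instance Twist.instRing (X : VecField R) : Ring (Twist X) :=
  inferInstanceAs (Ring (TrivSqZeroExt (TensorAlg R) (TensorAlg R)))

/-- The ring map `f ↦ f + ε X f`. -/
noncomputable def Twist.hom (X : VecField R) : R →+* Twist X where
  toFun f := ((algebraMap R (TensorAlg R) f, algebraMap R (TensorAlg R) (X f)) : TensorAlg R × TensorAlg R)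
  map_one' := by
    refine TrivSqZeroExt.ext ?_ ?_
    · exact map_one _
    · change algebraMap R (TensorAlg R) (X 1) = 0
      simp
  map_zero' := by
    refine TrivSqZeroExt.ext ?_ ?_
    · exact map_zero _
    · change algebraMap R (TensorAlg R) (X 0) = 0
      simp
  map_mul' f g := by
    refine TrivSqZeroExt.ext ?_ ?_
    · exact map_mul _ _ _
    · change algebraMap R (TensorAlg R) (X (f * g)) =
        algebraMap R (TensorAlg R) f * algebraMap R (TensorAlg R) (X g)
          + algebraMap R (TensorAlg R) (X f) * algebraMap R (TensorAlg R) g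
      rw [← map_mul, ← map_mul, ← map_add, X.leibniz, smul_eq_mul, smul_eq_mul, mul_comm g]
  map_add' f g := by
    refine TrivSqZeroExt.ext ?_ ?_
    · exact map_add _ _ _
    · change algebraMap R (TensorAlg R) (X (f + g)) = algebraMap R (TensorAlg R) (X f) + algebraMap R (TensorAlg R) (X g)
      simp

noncomputable instance Twist.instAlgebra (X : VecField R) : Algebra R (Twist X) :=
  (Twist.hom X).toAlgebra' fun f T => by
    refine TrivSqZeroExt.ext ?_ ?_
    · exact Algebra.commutes f (TrivSqZeroExt.fst T)
    · change algebraMap R (TensorAlg R) f * (TrivSqZeroExt.snd T)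
          + algebraMap R (TensorAlg R) (X f) * TrivSqZeroExt.fst T =
        TrivSqZeroExt.fst T * algebraMap R (TensorAlg R) (X f)
          + TrivSqZeroExt.snd T * algebraMap R (TensorAlg R) f
      rw [Algebra.commutes, Algebra.commutes, add_comm]

variable (C : AffineConnection R)

/-- The `R`-linear map `Y ↦ Y + ε ∇_X Y`. -/
noncomputable def twistι (X : VecField R) : VecField R →ₗ[R] Twist X where
  toFun Y := ((TensorAlgebra.ι R Y, TensorAlgebra.ι R (C.nabla X Y)) : TensorAlg R × TensorAlg R)
  map_add' Y Z := by
    refine TrivSqZeroExt.ext ?_ ?_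
    · exact map_add _ _ _
    · change TensorAlgebra.ι R (C.nabla X (Y + Z)) = TensorAlgebra.ι R (C.nabla X Y) +
        TensorAlgebra.ι R (C.nabla X Z)
      simp
  map_smul' f Y := by
    refine Eq.trans (TrivSqZeroExt.ext ?_ ?_) (Algebra.smul_def f _).symm
    · change TensorAlgebra.ι R (f • Y) = algebraMap R (TensorAlg R) f * _
      rw [map_smul, Algebra.smul_def]
    · change TensorAlgebra.ι R (C.nabla X (f • Y)) =
        algebraMap R (TensorAlg R) f * TensorAlgebra.ι R (C.nabla X Y)
          + algebraMap R (TensorAlg R) (X f) * TensorAlgebra.ι R Y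
      rw [C.leibniz, map_add, map_smul, map_smul, Algebra.smul_def, Algebra.smul_def, add_comm]

/-- The algebra map `A → A[ε]` extending `Y ↦ Y + ε ∇_X Y`; it is `U ↦ U + ε (X ▷ U)`. -/
noncomputable def twistLift (X : VecField R) : TensorAlg R →ₐ[R] Twist X := TensorAlgebra.lift R (twistι C X)

theorem twistLift_fst (X : VecField R) (U : TensorAlg R) : TrivSqZeroExt.fst (twistLift C X U) = U := by
  induction U using TensorAlgebra.induction with
  | algebraMap r => rw [AlgHom.commutes]; rfl
  | ι Y => rw [twistLift, TensorAlgebra.lift_ι_apply]; rfl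
  | add U V hU hV => rw [map_add]; exact congrArg₂ (· + ·) hU hV
  | mul U V hU hV => rw [map_mul]; exact congrArg₂ (· * ·) hU hV

/-- The covariant derivative `X ▷ U` of a tensor. -/
noncomputable def tensorFun (X : VecField R) (U : TensorAlg R) : TensorAlg R := TrivSqZeroExt.snd (twistLift C X U)

theorem tensorFun_add (X : VecField R) (U V : TensorAlg R) :
    tensorFun C X (U + V) = tensorFun C X U + tensorFun C X V := by
  unfold tensorFun; rw [map_add]; rfl

theorem tensorFun_mul (X : VecField R) (U V : TensorAlg R) :
    tensorFun C X (U * V) = tensorFun C X U * V + U * tensorFun C X V := by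
  unfold tensorFun
  rw [map_mul]
  change TrivSqZeroExt.fst (twistLift C X U) * _ + _ * TrivSqZeroExt.fst (twistLift C X V) = _
  rw [twistLift_fst, twistLift_fst, add_comm]; rfl

theorem tensorFun_algebraMap (X : VecField R) (f : R) :
    tensorFun C X (algebraMap R _ f) = algebraMap R _ (X f) := by
  unfold tensorFun; rw [AlgHom.commutes]; rfl

theorem tensorFun_ι (X Y : VecField R) :
    tensorFun C X (TensorAlgebra.ι R Y) = TensorAlgebra.ι R (C.nabla X Y) := by
  unfold tensorFun twistLift; rw [TensorAlgebra.lift_ι_apply]; rfl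

theorem tensorFun_smul (X : VecField R) (f : R) (U : TensorAlg R) :
    tensorFun C X (f • U) = X f • U + f • tensorFun C X U := by
  rw [Algebra.smul_def, tensorFun_mul, tensorFun_algebraMap, Algebra.smul_def, Algebra.smul_def]

theorem tensorFun_add_left (X Y : VecField R) (U : TensorAlg R) :
    tensorFun C (X + Y) U = tensorFun C X U + tensorFun C Y U := by
  induction U using TensorAlgebra.induction with
  | algebraMap r => simp [tensorFun_algebraMap]
  | ι Y => simp [tensorFun_ι]
  | add U V hU hV => simp only [tensorFun_add, hU, hV]; abel
  | mul U V hU hV => simp only [tensorFun_mul, hU, hV, add_mul, mul_add]; abel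

theorem tensorFun_smul_left (f : R) (X : VecField R) (U : TensorAlg R) :
    tensorFun C (f • X) U = f • tensorFun C X U := by
  induction U using TensorAlgebra.induction with
  | algebraMap r => simp [tensorFun_algebraMap, Algebra.smul_def]
  | ι Y => simp [tensorFun_ι]
  | add U V hU hV => simp only [tensorFun_add, hU, hV, smul_add]
  | mul U V hU hV => simp only [tensorFun_mul, hU, hV, smul_mul_assoc, mul_smul_comm, smul_add]

/-- The connection induced on the tensor algebra: `X ▷ f = X f`, `X ▷ Y = ∇_X Y`, and
`X ▷ (U V) = (X ▷ U) V + U (X ▷ V)`. -/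
noncomputable def tensor : ModuleConnection R (TensorAlg R) where
  nabla :=
    { toFun := fun X =>
        { toFun := tensorFun C X
          map_add' := tensorFun_add C X
          map_smul' := fun r U => by
            rw [← algebraMap_smul R r U, tensorFun_smul, Derivation.map_algebraMap, zero_smul,
              zero_add, algebraMap_smul, RingHom.id_apply] }
      map_add' := fun X Y => LinearMap.ext fun U => tensorFun_add_left C X Y U
      map_smul' := fun f X => LinearMap.ext fun U => tensorFun_smul_left C f X U }
  leibniz := tensorFun_smul C

theorem tensor_ι (X Y : VecField R) :
    (tensor C).nabla X (TensorAlgebra.ι R Y) = TensorAlgebra.ι R (C.nabla X Y) :=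
  tensorFun_ι C X Y

theorem tensor_mul (X : VecField R) (U V : TensorAlg R) :
    (tensor C).nabla X (U * V) = (tensor C).nabla X U * V + U * (tensor C).nabla X V :=
  tensorFun_mul C X U V

theorem tensor_algebraMap (X : VecField R) (f : R) :
    (tensor C).nabla X (algebraMap R _ f) = algebraMap R _ (X f) :=
  tensorFun_algebraMap C X f

/-- The space of tensors of degree `n`. -/
abbrev deg (R : Type*) [CommRing R] [Algebra ℝ R] (n : ℕ) : Submodule R (TensorAlg R) :=
  LinearMap.range (TensorAlgebra.ι R : VecField R →ₗ[R] TensorAlg R) ^ n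

theorem deg_zero (U : TensorAlg R) : U ∈ deg R 0 ↔ ∃ f, algebraMap R _ f = U := by
  rw [deg, Submodule.pow_zero, Submodule.mem_one]

theorem deg_succ (n : ℕ) :
    deg R (n + 1) = LinearMap.range (TensorAlgebra.ι R : VecField R →ₗ[R] TensorAlg R) * deg R n := by
  rw [deg, pow_succ']

theorem ι_mul_mem_deg (X : VecField R) (n : ℕ) (U : TensorAlg R) (hU : U ∈ deg R n) :
    TensorAlgebra.ι R X * U ∈ deg R (n + 1) := by
  rw [deg_succ]
  exact Submodule.mul_mem_mul ⟨_, rfl⟩ hU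

theorem tensor_mem_deg (X : VecField R) (n : ℕ) (U : TensorAlg R) (hU : U ∈ deg R n) :
    (tensor C).nabla X U ∈ deg R n := by
  induction hU using Submodule.pow_induction_on_left' with
  | algebraMap r => rw [tensor_algebraMap]; exact (deg_zero _).2 ⟨_, rfl⟩
  | add x y i hx hy ihx ihy => rw [map_add]; exact add_mem ihx ihy
  | mem_mul m hm i x hx ih =>
    obtain ⟨Y, rfl⟩ := hm
    rw [tensor_mul, tensor_ι]
    exact add_mem (ι_mul_mem_deg _ i _ hx) (ι_mul_mem_deg _ i _ ih)

/-- Multiplication `V ⊗ A → A`. -/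
noncomputable def mulLeft (R : Type*) [CommRing R] [Algebra ℝ R] : VecField R ⊗[R] TensorAlg R →ₗ[R] TensorAlg R :=
  TensorProduct.lift ((LinearMap.mul R (TensorAlg R)).comp (TensorAlgebra.ι R))

/-- Auxiliary to `split`: prepending the letter `X`. -/
noncomputable def splitStep (R : Type*) [CommRing R] [Algebra ℝ R] :
    VecField R →ₗ[R] Module.End R (R × (VecField R ⊗[R] TensorAlg R)) where
  toFun X := LinearMap.inr R R _ ∘ₗ TensorProduct.mk R (VecField R) (TensorAlg R) X ∘ₗ
    LinearMap.coprod (Algebra.linearMap R (TensorAlg R)) (mulLeft R)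
  map_add' X Y := by
    refine LinearMap.ext fun p => ?_
    simp
  map_smul' f X := by
    refine LinearMap.ext fun p => ?_
    simp

/-- The decomposition `A ≅ R ⊕ (V ⊗ A)` splitting off the first letter of each word. -/
noncomputable def split (R : Type*) [CommRing R] [Algebra ℝ R] :
    TensorAlg R →ₗ[R] R × (VecField R ⊗[R] TensorAlg R) :=
  (LinearMap.applyₗ ((1, 0) : R × (VecField R ⊗[R] TensorAlg R))) ∘ₗ
    (TensorAlgebra.lift R (splitStep R)).toLinearMap

theorem split_algebraMap (f : R) : split R (algebraMap R _ f) = (f, 0) := by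
  simp [split]

theorem split_ι_mul' (X : VecField R) (U : TensorAlg R) :
    split R (TensorAlgebra.ι R X * U) =
      (0, X ⊗ₜ (algebraMap R _ (split R U).1 + mulLeft R (split R U).2)) := by
  simp [split]
  rfl

theorem join_split (U : TensorAlg R) :
    algebraMap R _ (split R U).1 + mulLeft R (split R U).2 = U := by
  have h : ∀ n, ∀ U ∈ deg R n,
      algebraMap R _ (split R U).1 + mulLeft R (split R U).2 = U := by
    intro n U hU
    induction hU using Submodule.pow_induction_on_left' with
    | algebraMap r => simp [split_algebraMap]
    | add x y i hx hy ihx ihy =>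
      rw [map_add, Prod.fst_add, Prod.snd_add, map_add, map_add]
      nth_rewrite 3 [← ihx]
      nth_rewrite 3 [← ihy]
      abel
    | mem_mul m hm i x hx ih =>
      obtain ⟨Y, rfl⟩ := hm
      rw [split_ι_mul', ih]
      simp [mulLeft]
  induction U using DirectSum.Decomposition.inductionOn (deg R) with
  | zero => simp
  | homogeneous m => exact h _ _ m.2
  | add x y ihx ihy =>
    rw [map_add, Prod.fst_add, Prod.snd_add, map_add, map_add]
    nth_rewrite 3 [← ihx]
    nth_rewrite 3 [← ihy]
    abel

theorem split_ι_mul (X : VecField R) (U : TensorAlg R) :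
    split R (TensorAlgebra.ι R X * U) = (0, X ⊗ₜ U) := by
  rw [split_ι_mul', join_split]

variable {W : Type*} [AddCommGroup W] [Module ℝ W] [Module R W] [IsScalarTower ℝ R W]
  (D : ModuleConnection R W)

/-- `X ⊗ U ↦ ∇_X ∘ φ(U) - φ(∇_X U)`. -/
noncomputable def step (φ : TensorAlg R →ₗ[R] Module.End ℝ W) :
    VecField R ⊗[R] TensorAlg R →ₗ[R] Module.End ℝ W :=
  TensorProduct.lift (LinearMap.mk₂ R
    (fun X U => D.nabla X ∘ₗ φ U - φ ((tensor C).nabla X U))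
    (fun X Y U => by
      refine LinearMap.ext fun w => ?_
      simp; abel)
    (fun f X U => by
      refine LinearMap.ext fun w => ?_
      simp [smul_sub])
    (fun X U V => by
      refine LinearMap.ext fun w => ?_
      simp; abel)
    (fun f X U => by
      refine LinearMap.ext fun w => ?_
      simp [smul_sub, D.leibniz, (tensor C).leibniz]))

/-- One step of the recursion: `1 ↦ id` and `X U ↦ ∇_X ∘ φ(U) - φ(∇_X U)`. -/
noncomputable def next (φ : TensorAlg R →ₗ[R] Module.End ℝ W) : TensorAlg R →ₗ[R] Module.End ℝ W :=
  LinearMap.coprod (LinearMap.toSpanSingleton R _ (1 : Module.End ℝ W)) (step C D φ) ∘ₗ split R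

theorem next_algebraMap (φ : TensorAlg R →ₗ[R] Module.End ℝ W) (f : R) :
    next C D φ (algebraMap R _ f) = f • 1 := by
  simp [next, split_algebraMap]

theorem next_ι_mul (φ : TensorAlg R →ₗ[R] Module.End ℝ W) (X : VecField R) (U : TensorAlg R) :
    next C D φ (TensorAlgebra.ι R X * U) = D.nabla X * φ U - φ ((tensor C).nabla X U) := by
  simp [next, split_ι_mul, step]; rfl

theorem next_stable (n : ℕ) (k : ℕ) (U : TensorAlg R) (hU : U ∈ deg R n) :
    (next C D)^[n + 1 + k] 0 U = (next C D)^[n + 1] 0 U := by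
  induction n generalizing U with
  | zero =>
    obtain ⟨r, rfl⟩ := (deg_zero _).1 hU
    rw [show 0 + 1 + k = k + 1 by ring, Function.iterate_succ_apply', next_algebraMap,
      Function.iterate_succ_apply', next_algebraMap]
  | succ n ih =>
    rw [deg_succ] at hU
    refine Submodule.mul_induction_on hU ?_ ?_
    · rintro _ ⟨Y, rfl⟩ V hV
      rw [show n + 1 + 1 + k = (n + 1 + k) + 1 by ring, Function.iterate_succ_apply', next_ι_mul,
        Function.iterate_succ_apply', next_ι_mul, ih V hV, ih _ (tensor_mem_deg C Y n V hV)]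
    · intro V V' h h'
      rw [map_add, map_add, h, h']

/-- The action `U ▷ w` of the tensor algebra by higher-order covariant derivatives on a module with
connection. It is the `R`-linear map in `U` determined by `1 ▷ w = w` and
`(X U) ▷ w = X ▷ (U ▷ w) - (X ▷ U) ▷ w`, computed degree by degree. -/
noncomputable def higher : TensorAlg R →ₗ[R] Module.End ℝ W :=
  DirectSum.toModule R ℕ _ (fun n => (next C D)^[n + 1] 0 ∘ₗ (deg R n).subtype) ∘ₗ
    (DirectSum.decomposeLinearEquiv (deg R)).toLinearMap

theorem higher_deg (n : ℕ) (U : TensorAlg R) (hU : U ∈ deg R n) :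
    higher C D U = (next C D)^[n + 1] 0 U := by
  unfold higher
  rw [LinearMap.comp_apply, LinearEquiv.coe_coe, DirectSum.decomposeLinearEquiv_apply,
    DirectSum.decompose_of_mem _ hU]
  exact DirectSum.toModule_lof R (φ := fun n => (next C D)^[n + 1] 0 ∘ₗ (deg R n).subtype) n ⟨U, hU⟩

theorem higher_algebraMap (f : R) : higher C D (algebraMap R _ f) = f • 1 := by
  rw [higher_deg C D 0 _ ((deg_zero _).2 ⟨_, rfl⟩)]
  exact next_algebraMap C D _ f

theorem higher_one : higher C D 1 = 1 := by
  rw [← map_one (algebraMap R (TensorAlg R)), higher_algebraMap, one_smul]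

theorem higher_ι_mul (X : VecField R) (U : TensorAlg R) :
    higher C D (TensorAlgebra.ι R X * U) =
      D.nabla X * higher C D U - higher C D ((tensor C).nabla X U) := by
  induction U using DirectSum.Decomposition.inductionOn (deg R) with
  | zero => simp
  | @homogeneous n m =>
    rw [higher_deg C D n _ m.2, higher_deg C D n _ (tensor_mem_deg C X n _ m.2),
      higher_deg C D (n + 1) _ (ι_mul_mem_deg X n _ m.2), Function.iterate_succ_apply', next_ι_mul]
  | add x y ihx ihy =>
    simp only [mul_add, map_add, ihx, ihy]; abel

theorem higher_ι (X : VecField R) : higher C D (TensorAlgebra.ι R X) = D.nabla X := by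
  have h := higher_ι_mul C D X 1
  rw [higher_one, mul_one, mul_one, ← map_one (algebraMap R (TensorAlg R)), tensor_algebraMap] at h
  simpa using h

/-! ### The free Lie algebra -/

/-- The free `R`-Lie algebra `𝔤 = Lie_R(V)` on the module of vector fields: the Lie subalgebra of
the tensor algebra `T_R(V)` generated by `V`. -/
noncomputable def freeLie (R : Type*) [CommRing R] [Algebra ℝ R] : LieSubalgebra R (TensorAlg R) :=
  LieSubalgebra.lieSpan R (TensorAlg R) (Set.range (TensorAlgebra.ι R))

/-- The span of iterated brackets `[X₀,[X₁,…,[Xₙ₋₁,Xₙ]]]`. -/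
def iter (R : Type*) [CommRing R] [Algebra ℝ R] : ℕ → Submodule R (TensorAlg R)
  | 0 => LinearMap.range (TensorAlgebra.ι R)
  | n + 1 => Submodule.span R {u | ∃ X : VecField R, ∃ v ∈ iter R n, u = ⁅TensorAlgebra.ι R X, v⁆}

theorem ι_lie_mem (X : VecField R) (n : ℕ) (v : TensorAlg R) (hv : v ∈ iter R n) :
    ⁅TensorAlgebra.ι R X, v⁆ ∈ iter R (n + 1) :=
  Submodule.subset_span ⟨X, v, hv, rfl⟩

theorem iter_le (n : ℕ) (u : TensorAlg R) (hu : u ∈ iter R n) : u ∈ freeLie R := by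
  induction n generalizing u with
  | zero =>
    obtain ⟨X, rfl⟩ := hu
    exact LieSubalgebra.subset_lieSpan ⟨X, rfl⟩
  | succ n ih =>
    induction hu using Submodule.span_induction with
    | mem u h =>
      obtain ⟨X, v, hv, rfl⟩ := h
      exact (freeLie R).lie_mem (LieSubalgebra.subset_lieSpan ⟨X, rfl⟩) (ih v hv)
    | zero => exact zero_mem _
    | add x y _ _ hx hy => exact add_mem hx hy
    | smul a x _ hx => exact (freeLie R).smul_mem a hx

theorem iter_lie (m n : ℕ) (u v : TensorAlg R) (hu : u ∈ iter R m) (hv : v ∈ iter R n) :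
    ⁅u, v⁆ ∈ iter R (m + n + 1) := by
  induction m generalizing u v n with
  | zero =>
    obtain ⟨X, rfl⟩ := hu
    rw [zero_add]
    exact ι_lie_mem X n v hv
  | succ m ih =>
    induction hu using Submodule.span_induction with
    | mem u h =>
      obtain ⟨X, u, hu, rfl⟩ := h
      rw [lie_lie]
      refine sub_mem ?_ ?_
      · rw [show m + 1 + n + 1 = (m + n + 1) + 1 by ring]
        exact ι_lie_mem X _ _ (ih n u v hu hv)
      · rw [show m + 1 + n + 1 = m + (n + 1) + 1 by ring]
        exact ih (n + 1) u _ hu (ι_lie_mem X n v hv)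
    | zero => rw [zero_lie]; exact zero_mem _
    | add x y _ _ hx hy => rw [add_lie]; exact add_mem hx hy
    | smul a x _ hx => rw [smul_lie]; exact Submodule.smul_mem _ a hx

theorem iSup_iter_lie (u v : TensorAlg R) (hu : u ∈ ⨆ n, iter R n) (hv : v ∈ ⨆ n, iter R n) :
    ⁅u, v⁆ ∈ ⨆ n, iter R n := by
  induction hu using Submodule.iSup_induction' with
  | mem m x hx =>
    induction hv using Submodule.iSup_induction' with
    | mem n y hy => exact Submodule.mem_iSup_of_mem _ (iter_lie m n x y hx hy)
    | zero => rw [lie_zero]; exact zero_mem _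
    | add y y' _ _ h h' => rw [lie_add]; exact add_mem h h'
  | zero => rw [zero_lie]; exact zero_mem _
  | add x x' _ _ h h' => rw [add_lie]; exact add_mem h h'

theorem mem_iSup_iter (u : TensorAlg R) (hu : u ∈ freeLie R) : u ∈ ⨆ n, iter R n := by
  induction hu using LieSubalgebra.lieSpan_induction with
  | mem x h =>
    obtain ⟨X, rfl⟩ := h
    exact Submodule.mem_iSup_of_mem 0 ⟨X, rfl⟩
  | zero => exact zero_mem _
  | add x y _ _ hx hy => exact add_mem hx hy
  | smul a x _ hx => exact Submodule.smul_mem _ a hx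
  | lie x y _ _ hx hy => exact iSup_iter_lie x y hx hy

/-- The product `U ▷ V` on the tensor algebra, extending `X ▷ Y = ∇_X Y`. -/
noncomputable abbrev tri : TensorAlg R →ₗ[R] Module.End ℝ (TensorAlg R) := higher C (tensor C)

theorem tensor_lie (X : VecField R) (U V : TensorAlg R) :
    (tensor C).nabla X ⁅U, V⁆ = ⁅(tensor C).nabla X U, V⁆ + ⁅U, (tensor C).nabla X V⁆ := by
  simp only [Ring.lie_def, map_sub, tensor_mul]; abel

theorem tensor_mem_iter (X : VecField R) (n : ℕ) (u : TensorAlg R) (hu : u ∈ iter R n) :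
    (tensor C).nabla X u ∈ iter R n := by
  induction n generalizing u with
  | zero =>
    obtain ⟨Y, rfl⟩ := hu
    rw [tensor_ι]
    exact ⟨_, rfl⟩
  | succ n ih =>
    induction hu using Submodule.span_induction with
    | mem u h =>
      obtain ⟨Y, v, hv, rfl⟩ := h
      rw [tensor_lie, tensor_ι]
      exact add_mem (ι_lie_mem _ _ _ hv) (ι_lie_mem _ _ _ (ih v hv))
    | zero => rw [map_zero]; exact zero_mem _
    | add x y _ _ hx hy => rw [map_add]; exact add_mem hx hy
    | smul a x hx' hx => 
      rw [(tensor C).leibniz]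
      exact add_mem (Submodule.smul_mem _ _ hx') (Submodule.smul_mem _ a hx)

/-- The map `u ▷ -` preserves the span of iterated brackets of each length, is a derivation, and
`(u U) ▷ V = u ▷ (U ▷ V) - (u ▷ U) ▷ V`. -/
structure Good (u : TensorAlg R) : Prop where
  iter_mem : ∀ n, ∀ v ∈ iter R n, tri C u v ∈ iter R n
  mul : ∀ U V, tri C u (U * V) = tri C u U * V + U * tri C u V
  mul_left : ∀ U, tri C (u * U) = tri C u * tri C U - tri C (tri C u U)

theorem Good.lie {u : TensorAlg R} (h : Good C u) (U V : TensorAlg R) :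
    tri C u ⁅U, V⁆ = ⁅tri C u U, V⁆ + ⁅U, tri C u V⁆ := by
  simp only [Ring.lie_def, map_sub, h.mul]; abel

theorem good_ι (X : VecField R) : Good C (TensorAlgebra.ι R X) where
  iter_mem n v hv := by rw [higher_ι]; exact tensor_mem_iter C X n v hv
  mul U V := by rw [higher_ι]; exact tensor_mul C X U V
  mul_left U := by rw [higher_ι_mul, higher_ι]

theorem Good.zero : Good C (0 : TensorAlg R) where
  iter_mem n v hv := by simp
  mul U V := by simp
  mul_left U := by simp

theorem Good.add {u v : TensorAlg R} (hu : Good C u) (hv : Good C v) : Good C (u + v) where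
  iter_mem n w hw := by
    rw [map_add]; exact add_mem (hu.iter_mem n w hw) (hv.iter_mem n w hw)
  mul U V := by
    simp only [map_add, LinearMap.add_apply, hu.mul, hv.mul, add_mul, mul_add]; abel
  mul_left U := by
    simp only [add_mul, map_add, LinearMap.add_apply, hu.mul_left, hv.mul_left]; abel

theorem Good.smul {u : TensorAlg R} (f : R) (hu : Good C u) : Good C (f • u) where
  iter_mem n w hw := by
    rw [map_smul]; exact Submodule.smul_mem _ f (hu.iter_mem n w hw)
  mul U V := by
    simp only [map_smul, LinearMap.smul_apply, hu.mul, smul_add, smul_mul_assoc, mul_smul_comm]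
  mul_left U := by
    simp only [map_smul, LinearMap.smul_apply, hu.mul_left, smul_sub, smul_mul_assoc]

/-- If `u`, `v` and their mutual products act well, so does their bracket. -/
theorem Good.bracket {u v : TensorAlg R} (hu : Good C u) (hv : Good C v) (huv : Good C (tri C u v))
    (hvu : Good C (tri C v u)) : Good C ⁅u, v⁆ := by
  have key : tri C ⁅u, v⁆ =
      tri C u * tri C v - tri C v * tri C u - tri C (tri C u v) + tri C (tri C v u) := by
    rw [Ring.lie_def, map_sub, hu.mul_left, hv.mul_left]; abel
  refine ⟨fun n w hw => ?_, fun U V => ?_, fun U => ?_⟩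
  · rw [key]
    exact add_mem (sub_mem (sub_mem (hu.iter_mem _ _ (hv.iter_mem _ _ hw))
      (hv.iter_mem _ _ (hu.iter_mem _ _ hw))) (huv.iter_mem _ _ hw)) (hvu.iter_mem _ _ hw)
  · rw [key]
    simp only [LinearMap.add_apply, LinearMap.sub_apply, Module.End.mul_apply, hu.mul, hv.mul,
      huv.mul, hvu.mul, map_add, mul_add, add_mul, mul_sub, sub_mul]
    abel
  · rw [key]
    simp only [Ring.lie_def, sub_mul, mul_assoc, map_sub, hu.mul_left, hv.mul_left, hu.mul, hv.mul,
      map_add, huv.mul_left, hvu.mul_left, LinearMap.add_apply, LinearMap.sub_apply,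
      Module.End.mul_apply, mul_sub, add_mul]
    abel

theorem good_iter (n : ℕ) (u : TensorAlg R) (hu : u ∈ iter R n) : Good C u := by
  induction n generalizing u with
  | zero => obtain ⟨X, rfl⟩ := hu; exact good_ι C X
  | succ n ih =>
    induction hu using Submodule.span_induction with
    | mem u h =>
      obtain ⟨X, v, hv, rfl⟩ := h
      have hv' := ih v hv
      refine (good_ι C X).bracket C hv' ?_ ?_
      · exact ih _ ((good_ι C X).iter_mem n v hv)
      · obtain ⟨Y, hY⟩ := hv'.iter_mem 0 _ ⟨X, rfl⟩
        rw [← hY]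
        exact good_ι C Y
    | zero => exact Good.zero C
    | add x y _ _ hx hy => exact hx.add C hy
    | smul a x _ hx => exact hx.smul C a

theorem good_freeLie (u : TensorAlg R) (hu : u ∈ freeLie R) : Good C u := by
  induction mem_iSup_iter u hu using Submodule.iSup_induction' with
  | mem n x hx => exact good_iter C n x hx
  | zero => exact Good.zero C
  | add x y hx hy h h' =>
    have aux : ∀ z ∈ ⨆ n, iter R n, z ∈ freeLie R := fun z hz =>
      (iSup_le fun n => iter_le n : ⨆ n, iter R n ≤ (freeLie R).toSubmodule) hz
    exact (h (aux x hx)).add C (h' (aux y hy))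

theorem tri_mem (u v : TensorAlg R) (hu : u ∈ freeLie R) (hv : v ∈ freeLie R) :
    tri C u v ∈ freeLie R := by
  induction mem_iSup_iter v hv using Submodule.iSup_induction' with
  | mem n x hx => exact iter_le n _ ((good_freeLie C u hu).iter_mem n x hx)
  | zero => rw [map_zero]; exact zero_mem _
  | add x y hx hy h h' =>
    have aux : ∀ z ∈ ⨆ n, iter R n, z ∈ freeLie R := fun z hz =>
      (iSup_le fun n => iter_le n : ⨆ n, iter R n ≤ (freeLie R).toSubmodule) hz
    rw [map_add]
    exact add_mem (h (aux x hx)) (h' (aux y hy))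

theorem freeLie_induction {P : TensorAlg R → Prop} (hι : ∀ X, P (TensorAlgebra.ι R X)) (h0 : P 0)
    (hadd : ∀ u v, P u → P v → P (u + v)) (hsmul : ∀ (f : R) (u), P u → P (f • u))
    (hlie : ∀ u v, u ∈ freeLie R → v ∈ freeLie R → P u → P v → P (tri C u v) → P (tri C v u) →
      P ⁅u, v⁆) (u : TensorAlg R) (hu : u ∈ freeLie R) : P u := by
  have h : ∀ n, ∀ u ∈ iter R n, P u := by
    intro n
    induction n with
    | zero => rintro _ ⟨X, rfl⟩; exact hι X
    | succ n ih =>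
      intro u hu
      induction hu using Submodule.span_induction with
      | mem u h =>
        obtain ⟨X, v, hv, rfl⟩ := h
        refine hlie _ _ (iter_le 0 _ ⟨X, rfl⟩) (iter_le n v hv) (hι X) (ih v hv) ?_ ?_
        · exact ih _ ((good_ι C X).iter_mem n v hv)
        · obtain ⟨Y, hY⟩ := (good_iter C n v hv).iter_mem 0 _ ⟨X, rfl⟩
          rw [← hY]
          exact hι Y
      | zero => exact h0
      | add x y _ _ hx hy => exact hadd _ _ hx hy
      | smul a x _ hx => exact hsmul _ _ hx
  induction mem_iSup_iter u hu using Submodule.iSup_induction' with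
  | mem n x hx => exact h n x hx
  | zero => exact h0
  | add x y hx hy h h' =>
    have aux : ∀ z ∈ ⨆ n, iter R n, z ∈ freeLie R := fun z hz =>
      (iSup_le fun n => iter_le n : ⨆ n, iter R n ≤ (freeLie R).toSubmodule) hz
    exact hadd _ _ (h (aux x hx)) (h' (aux y hy))

theorem higher_mul_left (u : TensorAlg R) (hu : u ∈ freeLie R) (U : TensorAlg R) :
    higher C D (u * U) = higher C D u * higher C D U - higher C D (tri C u U) := by
  refine freeLie_induction C
    (P := fun u => ∀ U, higher C D (u * U) = higher C D u * higher C D U - higher C D (tri C u U))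
    ?_ ?_ ?_ ?_ ?_ u hu U
  · intro X U
    rw [higher_ι_mul, higher_ι, higher_ι]
  · intro U; simp
  · intro u v hu hv U
    simp only [add_mul, map_add, LinearMap.add_apply, hu, hv]; abel
  · intro f u hu U
    simp only [map_smul, LinearMap.smul_apply, hu, smul_sub, smul_mul_assoc]
  · intro u v hu hv hu' hv' huv hvu U
    have hu := good_freeLie C u hu
    have hv := good_freeLie C v hv
    simp only [Ring.lie_def, sub_mul, mul_assoc, map_sub, hu.mul_left, hv.mul_left, hu.mul, hv.mul,
      hu', hv', map_add, huv, hvu, LinearMap.sub_apply, Module.End.mul_apply, mul_sub]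
    abel

theorem higher_lie (u v : TensorAlg R) (hu : u ∈ freeLie R) (hv : v ∈ freeLie R) :
    higher C D ⁅u, v⁆ = higher C D u * higher C D v - higher C D v * higher C D u
      - higher C D (tri C u v) + higher C D (tri C v u) := by
  rw [Ring.lie_def, map_sub, higher_mul_left C D u hu, higher_mul_left C D v hv]; abel

theorem higher_trivial_leibniz (u : TensorAlg R) (hu : u ∈ freeLie R) (f g : R) :
    higher C (trivial R) u (f * g) =
      f * higher C (trivial R) u g + g * higher C (trivial R) u f := by
  refine freeLie_induction C
    (P := fun u => ∀ f g, higher C (trivial R) u (f * g) =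
      f * higher C (trivial R) u g + g * higher C (trivial R) u f)
    ?_ ?_ ?_ ?_ ?_ u hu f g
  · intro X f g
    rw [higher_ι]
    exact X.leibniz f g
  · intro f g; simp
  · intro u v hu hv f g
    simp only [map_add, LinearMap.add_apply, hu, hv]; ring
  · intro a u hu f g
    simp only [map_smul, LinearMap.smul_apply, hu, smul_eq_mul]; ring
  · intro u v hu hv hu' hv' huv hvu f g
    rw [higher_lie C _ u v hu hv]
    simp only [LinearMap.add_apply, LinearMap.sub_apply, Module.End.mul_apply, hu', hv', huv, hvu,
      map_add]
    ring

theorem gl_mem (u v : TensorAlg R) (hu : u ∈ freeLie R) (hv : v ∈ freeLie R) :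
    tri C u v - tri C v u + ⁅u, v⁆ ∈ freeLie R :=
  add_mem (sub_mem (tri_mem C u v hu hv) (tri_mem C v u hv hu)) ((freeLie R).lie_mem hu hv)

theorem gl_leibniz (u v w : TensorAlg R) (hu : u ∈ freeLie R) (hv : v ∈ freeLie R) (hw : w ∈ freeLie R) :
    (tri C u (tri C v w - tri C w v + ⁅v, w⁆) - tri C (tri C v w - tri C w v + ⁅v, w⁆) u
      + ⁅u, tri C v w - tri C w v + ⁅v, w⁆⁆) =
    (tri C (tri C u v - tri C v u + ⁅u, v⁆) w - tri C w (tri C u v - tri C v u + ⁅u, v⁆)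
      + ⁅tri C u v - tri C v u + ⁅u, v⁆, w⁆) +
    (tri C v (tri C u w - tri C w u + ⁅u, w⁆) - tri C (tri C u w - tri C w u + ⁅u, w⁆) v
      + ⁅v, tri C u w - tri C w u + ⁅u, w⁆⁆) := by
  simp only [map_add, map_sub, higher_lie C _ _ _ hu hv, higher_lie C _ _ _ hv hw,
    higher_lie C _ _ _ hu hw, LinearMap.add_apply, LinearMap.sub_apply, Module.End.mul_apply,
    (good_freeLie C u hu).lie, (good_freeLie C v hv).lie, (good_freeLie C w hw).lie,
    lie_add, lie_sub, add_lie, sub_lie]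
  rw [leibniz_lie u v w, ← lie_skew v (tri C w u)]
  abel

/-- The `R`-module `𝔤 = Lie_R(V)`, made into a real Lie algebra below by the Grossman-Larson bracket
of the connection `C`. -/
def GLAlg (_ : AffineConnection R) : Type _ := freeLie R

noncomputable instance GLAlg.instAddCommGroup : AddCommGroup (GLAlg C) := inferInstanceAs (AddCommGroup (freeLie R))
noncomputable instance GLAlg.instModule : Module R (GLAlg C) := inferInstanceAs (Module R (freeLie R))
noncomputable instance GLAlg.instModuleReal : Module ℝ (GLAlg C) := inferInstanceAs (Module ℝ (freeLie R))
instance GLAlg.instIsScalarTower : IsScalarTower ℝ R (GLAlg C) := inferInstanceAs (IsScalarTower ℝ R (freeLie R))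

/-- The post-Lie product `u ▷ v` on `𝔤`. -/
noncomputable def GLAlg.tri (u v : GLAlg C) : GLAlg C :=
  (⟨ModuleConnection.tri C u.1 v.1, tri_mem C _ _ u.2 v.2⟩ : freeLie R)

/-- The free Lie bracket `[u, v]` on `𝔤`. -/
noncomputable def GLAlg.freeBracket (u v : GLAlg C) : GLAlg C :=
  (⟨⁅u.1, v.1⁆, (freeLie R).lie_mem u.2 v.2⟩ : freeLie R)

/-- The Grossman-Larson bracket `⟦u, v⟧ = u ▷ v - v ▷ u + [u, v]`. -/
noncomputable instance GLAlg.instBracket : Bracket (GLAlg C) (GLAlg C) where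
  bracket u v := GLAlg.tri C u v - GLAlg.tri C v u + GLAlg.freeBracket C u v

noncomputable instance GLAlg.instLieRing : LieRing (GLAlg C) where
  add_lie u v w := Subtype.ext <| by
    change ModuleConnection.tri C (u.1 + v.1) w.1 - ModuleConnection.tri C w.1 (u.1 + v.1)
      + ⁅u.1 + v.1, w.1⁆ = (ModuleConnection.tri C u.1 w.1 - ModuleConnection.tri C w.1 u.1
        + ⁅u.1, w.1⁆) + (ModuleConnection.tri C v.1 w.1 - ModuleConnection.tri C w.1 v.1
        + ⁅v.1, w.1⁆)
    simp only [map_add, LinearMap.add_apply, add_lie]; abel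
  lie_add u v w := Subtype.ext <| by
    change ModuleConnection.tri C u.1 (v.1 + w.1) - ModuleConnection.tri C (v.1 + w.1) u.1
      + ⁅u.1, v.1 + w.1⁆ = (ModuleConnection.tri C u.1 v.1 - ModuleConnection.tri C v.1 u.1
        + ⁅u.1, v.1⁆) + (ModuleConnection.tri C u.1 w.1 - ModuleConnection.tri C w.1 u.1
        + ⁅u.1, w.1⁆)
    simp only [map_add, LinearMap.add_apply, lie_add]; abel
  lie_self u := Subtype.ext <| by
    change ModuleConnection.tri C u.1 u.1 - ModuleConnection.tri C u.1 u.1 + ⁅u.1, u.1⁆ = 0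
    rw [sub_self, lie_self, add_zero]
  leibniz_lie u v w := Subtype.ext (gl_leibniz C u.1 v.1 w.1 u.2 v.2 w.2)

noncomputable instance GLAlg.instLieAlgebra : LieAlgebra ℝ (GLAlg C) where
  lie_smul r u v := Subtype.ext <| by
    change ModuleConnection.tri C u.1 (r • v.1) - ModuleConnection.tri C (r • v.1) u.1
      + ⁅u.1, r • v.1⁆ = r • (ModuleConnection.tri C u.1 v.1 - ModuleConnection.tri C v.1 u.1
        + ⁅u.1, v.1⁆)
    rw [map_smul, LinearMap.map_smul_of_tower, LinearMap.smul_apply, Ring.lie_def, Ring.lie_def,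
      mul_smul_comm, smul_mul_assoc, smul_add, smul_sub, smul_sub]

/-- The inclusion of `V` in `𝔤`. -/
noncomputable def GLAlg.incl : VecField R →ₗ[R] GLAlg C :=
  (LinearMap.codRestrict (freeLie R).toSubmodule (TensorAlgebra.ι R)
    (fun X => iter_le 0 _ ⟨X, rfl⟩) : VecField R →ₗ[R] freeLie R)

/-- The anchor `ρ : 𝔤 → V`, given by the action `ρ(u) f = u ▷ f` on functions. -/
noncomputable def GLAlg.anchor : GLAlg C →ₗ[R] VecField R where
  toFun u := Derivation.mk' (higher C (trivial R) u.1) (higher_trivial_leibniz C u.1 u.2)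
  map_add' u v := Derivation.ext fun f =>
    LinearMap.congr_fun (map_add (higher C (trivial R)) u.1 v.1) f
  map_smul' a u := Derivation.ext fun f =>
    LinearMap.congr_fun (map_smul (higher C (trivial R)) a u.1) f

/-- The curvature element `s(a.b)`: the Grossman-Larson bracket of `a` and `b` in `𝔤` minus their
Jacobi bracket. -/
noncomputable def GLAlg.curvatureElt (a b : VecField R) : GLAlg C :=
  ⁅GLAlg.incl C a, GLAlg.incl C b⁆ - GLAlg.incl C ⁅a, b⁆

end ModuleConnection

/-!
The argument is purely algebraic and uses nothing about `R = C^∞(M)` beyond its being a commutative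
`ℝ`-algebra.

The anchor `ρ` is a morphism for the Grossman-Larson bracket (`anchor_lie`) and restricts to the
identity on vector fields (`anchor_incl`). The second fact splits `𝔤` as `V ⊕ ker ρ`; the two
together give `ρ(s(a.b)) = 0`, so that the ideal `J'` generated by the curvature elements lies in
`ker ρ`.

For the reverse inclusion it suffices that `𝔤 = V + J'`, since the `V`-part of an element is its
image under `ρ`. The ideal `J'` is a priori only a real subspace. It is an `R`-submodule because
`s(a.b)` is `R`-linear in `a` and `⟦u, f v⟧ = f ⟦u, v⟧ + ρ(u)(f) v` (`lie_smul_eq`): the elements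
of `J'` all of whose `R`-multiples stay in `J'` form an ideal containing the generators
(`smul_mem_curvatureIdeal`). Finally `𝔤` is spanned over `R` by iterated free brackets of vector
fields, and
`[X, v] = ⟦X, v⟧ - X ▷ v + v ▷ X`
lets one induct on their length: `X ▷ v` has the length of `v`, `v ▷ X` is a vector field, and
`⟦X, Y⟧ = s(X.Y) + ⟦X, Y⟧_V` for a vector field `Y` (`exists_incl_add_mem_curvatureIdeal`).
-/

namespace ModuleConnection

variable {R : Type*} [CommRing R] [Algebra ℝ R] (C : AffineConnection R)

/-- On functions, the action of `𝔤` on the tensor algebra is the one defining the anchor. -/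
theorem tri_algebraMap (u : TensorAlg R) (hu : u ∈ freeLie R) (f : R) :
    tri C u (algebraMap R _ f) = algebraMap R _ (higher C (trivial R) u f) := by
  refine freeLie_induction C
    (P := fun u => ∀ f, tri C u (algebraMap R _ f) = algebraMap R _ (higher C (trivial R) u f))
    ?_ ?_ ?_ ?_ ?_ u hu f
  · intro X f
    rw [higher_ι, higher_ι, tensor_algebraMap]
    rfl
  · intro f; simp
  · intro u v hu hv f
    simp only [map_add, LinearMap.add_apply, hu, hv]
  · intro a u hu f
    rw [map_smul, map_smul, LinearMap.smul_apply, LinearMap.smul_apply, hu, smul_eq_mul, map_mul,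
      Algebra.smul_def]
  · intro u v hu hv hu' hv' huv hvu f
    rw [higher_lie C _ u v hu hv, higher_lie C _ u v hu hv]
    simp only [LinearMap.add_apply, LinearMap.sub_apply, Module.End.mul_apply, hu', hv', huv, hvu,
      map_add, map_sub]

theorem tri_smul (u : TensorAlg R) (hu : u ∈ freeLie R) (f : R) (v : TensorAlg R) :
    tri C u (f • v) = higher C (trivial R) u f • v + f • tri C u v := by
  rw [Algebra.smul_def, (good_freeLie C u hu).mul, tri_algebraMap C u hu, Algebra.smul_def,
    Algebra.smul_def]

namespace GLAlg

theorem bracket_val (u v : GLAlg C) :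
    (⁅u, v⁆ : GLAlg C).1 =
      ModuleConnection.tri C u.1 v.1 - ModuleConnection.tri C v.1 u.1 + ⁅u.1, v.1⁆ := rfl

theorem anchor_apply (u : GLAlg C) (f : R) :
    anchor C u f = higher C (trivial R) u.1 f := rfl

theorem anchor_incl (X : VecField R) : anchor C (incl C X) = X :=
  Derivation.ext fun f => LinearMap.congr_fun (higher_ι C (trivial R) X) f

theorem anchor_lie (u v : GLAlg C) : anchor C ⁅u, v⁆ = ⁅anchor C u, anchor C v⁆ := by
  refine Derivation.ext fun f => ?_
  rw [Derivation.commutator_apply, anchor_apply, bracket_val, map_add, map_sub,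
    higher_lie C _ _ _ u.2 v.2]
  simp only [anchor_apply, LinearMap.add_apply, LinearMap.sub_apply, Module.End.mul_apply]
  abel

theorem lie_smul_eq (u v : GLAlg C) (f : R) :
    ⁅u, f • v⁆ = f • ⁅u, v⁆ + anchor C u f • v := by
  refine Subtype.ext ?_
  change ModuleConnection.tri C u.1 (f • v.1) - ModuleConnection.tri C (f • v.1) u.1
    + ⁅u.1, f • v.1⁆ = f • (ModuleConnection.tri C u.1 v.1 - ModuleConnection.tri C v.1 u.1
      + ⁅u.1, v.1⁆) + higher C (trivial R) u.1 f • v.1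
  rw [tri_smul C u.1 u.2, map_smul, LinearMap.smul_apply, Ring.lie_def, Ring.lie_def,
    mul_smul_comm, smul_mul_assoc, smul_add, smul_sub, smul_sub]
  abel

theorem curvatureElt_smul_left (f : R) (a b : VecField R) :
    curvatureElt C (f • a) b = f • curvatureElt C a b := by
  -- the two Leibniz terms, in `⟦b, f a⟧` and in the Jacobi bracket, cancel
  have h : ⁅f • a, b⁆ = f • ⁅a, b⁆ - b f • a := by
    ext g
    simp only [Derivation.commutator_apply, Derivation.smul_apply, Derivation.sub_apply,
      Derivation.leibniz, smul_eq_mul]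
    ring
  rw [curvatureElt, curvatureElt, map_smul, ← lie_skew, lie_smul_eq, ← lie_skew (incl C a),
    anchor_incl, h, map_sub, map_smul, map_smul, smul_sub, smul_neg]
  abel

theorem anchor_curvatureElt (a b : VecField R) : anchor C (curvatureElt C a b) = 0 := by
  rw [curvatureElt, map_sub, anchor_lie, anchor_incl, anchor_incl, anchor_incl, sub_self]

/-- The ideal of the real Lie algebra `𝔤` generated by the curvature elements. -/
noncomputable abbrev curvatureIdeal : LieIdeal ℝ (GLAlg C) :=
  LieSubmodule.lieSpan ℝ (GLAlg C) {s | ∃ a b : VecField R, s = curvatureElt C a b}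

theorem curvatureElt_mem (a b : VecField R) : curvatureElt C a b ∈ curvatureIdeal C :=
  LieSubmodule.subset_lieSpan ⟨a, b, rfl⟩

theorem anchor_eq_zero_of_mem (u : GLAlg C) (hu : u ∈ curvatureIdeal C) : anchor C u = 0 := by
  induction hu using LieSubmodule.lieSpan_induction with
  | mem x h => obtain ⟨a, b, rfl⟩ := h; exact anchor_curvatureElt C a b
  | zero => exact map_zero _
  | add x y _ _ hx hy => rw [map_add, hx, hy, add_zero]
  | smul r x _ hx => rw [LinearMap.map_smul_of_tower, hx, smul_zero]
  | lie x y _ hy => rw [anchor_lie, hy, lie_zero]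

/-- The curvature ideal, defined as a real subspace, is an `R`-submodule. -/
theorem smul_mem_curvatureIdeal (f : R) (u : GLAlg C) (hu : u ∈ curvatureIdeal C) :
    f • u ∈ curvatureIdeal C := by
  induction hu using LieSubmodule.lieSpan_induction generalizing f with
  | mem x h =>
    obtain ⟨a, b, rfl⟩ := h
    rw [← curvatureElt_smul_left]
    exact curvatureElt_mem C _ b
  | zero => rw [smul_zero]; exact zero_mem _
  | add x y _ _ hx hy => rw [smul_add]; exact add_mem (hx f) (hy f)
  | smul r x _ hx => rw [smul_algebra_smul_comm]; exact (curvatureIdeal C).smul_mem r (hx f)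
  | lie x y _ hy =>
    rw [← add_sub_cancel_right (f • ⁅x, y⁆) (anchor C x f • y), ← lie_smul_eq]
    exact sub_mem ((curvatureIdeal C).lie_mem (hy f)) (hy _)

/-- Every element of `𝔤` is a vector field modulo the curvature ideal. -/
theorem exists_incl_add_mem_curvatureIdeal (u : GLAlg C) :
    ∃ X : VecField R, ∃ j ∈ curvatureIdeal C, u = incl C X + j := by
  -- the `R`-submodule `V + J'`, carried over to the tensor algebra
  let S : Submodule R (TensorAlg R) :=
    { carrier := {w | ∃ X : VecField R, ∃ j ∈ curvatureIdeal C, w = (incl C X + j : GLAlg C).1}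
      zero_mem' := ⟨0, 0, zero_mem _, by rw [map_zero, add_zero]; rfl⟩
      add_mem' := by
        rintro _ _ ⟨X, j, hj, rfl⟩ ⟨Y, k, hk, rfl⟩
        refine ⟨X + Y, j + k, add_mem hj hk, ?_⟩
        rw [map_add, add_add_add_comm]
        rfl
      smul_mem' := by
        rintro f _ ⟨X, j, hj, rfl⟩
        refine ⟨f • X, f • j, smul_mem_curvatureIdeal C f j hj, ?_⟩
        rw [map_smul, ← smul_add]
        rfl }
  have hS : ∀ n, iter R n ≤ S := by
    intro n
    induction n with
    | zero =>
      rintro _ ⟨X, rfl⟩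
      exact ⟨X, 0, zero_mem _, by rw [add_zero]; rfl⟩
    | succ n ih =>
      refine Submodule.span_le.2 ?_
      rintro _ ⟨X, v, hv, rfl⟩
      have h₁ : ModuleConnection.tri C (TensorAlgebra.ι R X) v ∈ S :=
        ih ((good_ι C X).iter_mem n v hv)
      have h₂ : ModuleConnection.tri C v (TensorAlgebra.ι R X) ∈ S := by
        obtain ⟨Y, hY⟩ := (good_iter C n v hv).iter_mem 0 _ ⟨X, rfl⟩
        rw [← hY]
        exact ⟨Y, 0, zero_mem _, by rw [add_zero]; rfl⟩
      obtain ⟨Y, j, hj, rfl⟩ := ih hv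
      have h₃ : (⁅incl C X, incl C Y + j⁆ : GLAlg C).1 ∈ S := by
        refine ⟨⁅X, Y⁆, curvatureElt C X Y + ⁅incl C X, j⁆,
          add_mem (curvatureElt_mem C X Y) ((curvatureIdeal C).lie_mem hj), ?_⟩
        rw [lie_add, curvatureElt]
        congr 1
        abel
      rw [bracket_val] at h₃
      have h := add_mem (sub_mem h₃ h₁) h₂
      change _ ∈ S
      convert h using 1
      change _ = ModuleConnection.tri C (TensorAlgebra.ι R X) _
        - ModuleConnection.tri C _ (TensorAlgebra.ι R X) + ⁅TensorAlgebra.ι R X, _⁆ - _ + _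
      abel
  obtain ⟨X, j, hj, h⟩ := iSup_le hS (mem_iSup_iter u.1 u.2)
  exact ⟨X, j, hj, Subtype.ext h⟩

theorem curvatureIdeal_eq_ker :
    (curvatureIdeal C).toSubmodule = (LinearMap.ker (anchor C)).restrictScalars ℝ := by
  refine le_antisymm (fun u hu => anchor_eq_zero_of_mem C u hu) fun u hu => ?_
  obtain ⟨X, j, hj, rfl⟩ := exists_incl_add_mem_curvatureIdeal C u
  have h : anchor C (incl C X + j) = 0 := hu
  rw [map_add, anchor_incl, anchor_eq_zero_of_mem C j hj, add_zero] at h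
  rw [h, map_zero, zero_add]
  exact hj

theorem isCompl_range_incl_ker_anchor :
    IsCompl (LinearMap.range (incl C)) (LinearMap.ker (anchor C)) := by
  refine ⟨Submodule.disjoint_def.2 ?_, Submodule.codisjoint_iff_exists_add_eq.2 fun u => ?_⟩
  · rintro _ ⟨X, rfl⟩ hX
    rw [LinearMap.mem_ker, anchor_incl] at hX
    rw [hX, map_zero]
  · refine ⟨incl C (anchor C u), u - incl C (anchor C u), ⟨_, rfl⟩, ?_, add_sub_cancel _ _⟩
    rw [LinearMap.mem_ker, map_sub, anchor_incl, sub_self]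

end GLAlg

end ModuleConnection

theorem mainTheorem2 {E : Type*} [NormedAddCommGroup E] [NormedSpace ℝ E] [FiniteDimensional ℝ E]
    {M : Type*} [TopologicalSpace M] [T2Space M] [ParacompactSpace M] [ChartedSpace E M]
    [IsManifold (modelWithCornersSelf ℝ E) ∞ M]
    (C : AffineConnection C^∞⟮modelWithCornersSelf ℝ E, M; ℝ⟯) :
    (LieSubmodule.lieSpan ℝ (ModuleConnection.GLAlg C)
        {s | ∃ a b : VecField C^∞⟮modelWithCornersSelf ℝ E, M; ℝ⟯,
          s = ModuleConnection.GLAlg.curvatureElt C a b} :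
        LieIdeal ℝ (ModuleConnection.GLAlg C)).toSubmodule =
      (LinearMap.ker (ModuleConnection.GLAlg.anchor C)).restrictScalars ℝ ∧
    IsCompl (LinearMap.range (ModuleConnection.GLAlg.incl C))
      (LinearMap.ker (ModuleConnection.GLAlg.anchor C)) := by
  exact ⟨ModuleConnection.GLAlg.curvatureIdeal_eq_ker C,
    ModuleConnection.GLAlg.isCompl_range_incl_ker_anchor C⟩
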